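/- Let $p\ge 1$. A first-order $p$-SCLI ($p$-stationary canonical linear iterative algorithm) $\mathcal A$ is given by real scalars $\alpha_0,\dots,\alpha_{p-1},\beta_0,\dots,\beta_{p-1}$. Applied to an operator $F:\mathbb R^n\to\mathbb R^n$ with initialization points $x^{0},x^{-1},\dots,x^{-p+1}\in\mathbb R^n$, it generates the iterates $$x^{t}=\sum_{j=0}^{p-1}\bigl(\alpha_j\,F(x^{t-p+j})+\beta_j\,x^{t-p+j}\bigr),\qquad t=1,2,\dots.$$ For $n\ge 1$ and $\ell,D>0$ let $\mathcal F^{\mathrm{quad}}_{n,\ell,D}$ be the class of functions $f:\mathbb R^n\to\mathbb R$ of the form $f(x)=\tfrac12x^\top Sx+b^\top x$, with $S$ a (symmetric) positive definite matrix and $b\in\mathbb R^n$, that are $\ell$-smooth (the gradient is $\ell$-Lipschitz in the Euclidean norm) and whose minimizer $x^*=-S^{-1}b$ satisfies $\|x^*\|\le D$. **Proposition.** Let $\mathcal A$ be a $p$-SCLI. Then there are constants $c_{\mathcal A}>0$ and $T_{\mathcal A}\in\{1,2,\dots\}$, depending only on $\mathcal A$, such that the following holds for all $n\ge1$, $\ell>0$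 and $D>0$. For every integer $T\ge T_{\mathcal A}$ there are a function $f\in\mathcal F^{\mathrm{quad}}_{n,\ell,D}$ and initialization points $x^{0},\dots,x^{-p+1}$ of Euclidean norm at most $D$ such that the $T$-th iterate $x^T$ of $\mathcal A$ applied to $F=\nabla f$ satisfies $$f(x^{T})-f(x^*)\ \ge\ \frac{c_{\mathcal A}\,\ell D^2}{T}.$$ -/

import Mathlib

open Matrix

noncomputable section

/-- A first-order `p`-stationary canonical linear iterative algorithm (`p`-SCLI): it is given by its
scalar coefficients `α_0, …, α_{p-1}` and `β_0, …, β_{p-1}`. -/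
structure SCLI (p : ℕ) where
  α : Fin p → ℝ
  β : Fin p → ℝ

namespace SCLI

variable {p : ℕ} {E : Type*} [AddCommGroup E] [Module ℝ E]

/-- The iterates of a `p`-SCLI on the operator `F`, numbered from the oldest initialization point:
`A.orbit F init s` is `z^{s-p+1}`, and `init j` is `z^{-p+1+j}`. -/
def orbit (A : SCLI p) (F : E → E) (init : Fin p → E) (s : ℕ) : E :=
  if h : s < p then init ⟨s, h⟩
  else ∑ j : Fin p, (A.α j • F (A.orbit F init (s - p + j)) + A.β j • A.orbit F init (s - p + j))
termination_by s
decreasing_by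
  all_goals have := j.isLt; omega

/-- The iterate `z^t`, for integers `t ≥ -p+1`. -/
def iterate (A : SCLI p) (F : E → E) (init : Fin p → E) (t : ℤ) : E :=
  A.orbit F init (t + p - 1).toNat

/-- The first `p` iterates `z^{-p+1}, …, z^0` are the initialization points. -/
theorem iterate_init (A : SCLI p) (F : E → E) (init : Fin p → E) (j : Fin p) :
    A.iterate F init (-(p : ℤ) + 1 + j) = init j := by
  have hj := j.isLt
  have h : (-(p : ℤ) + 1 + j + p - 1).toNat = (j : ℕ) := by omega
  rw [iterate, h, orbit, dif_pos hj]

/-- The defining recursion of a `p`-SCLI: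
`z^t = ∑_{j=0}^{p-1} (α_j F(z^{t-p+j}) + β_j z^{t-p+j})` for `t ≥ 1`. -/
theorem iterate_eq (A : SCLI p) (F : E → E) (init : Fin p → E) (t : ℤ) (ht : 1 ≤ t) :
    A.iterate F init t =
      ∑ j : Fin p, (A.α j • F (A.iterate F init (t - p + j))
        + A.β j • A.iterate F init (t - p + j)) := by
  have h : ¬ (t + p - 1).toNat < p := by omega
  rw [iterate, orbit, dif_neg h]
  refine Finset.sum_congr rfl fun j _ => ?_
  have hj : (t + p - 1).toNat - p + (j : ℕ) = (t - p + j + p - 1).toNat := by omega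
  rw [hj]
  rfl

end SCLI

/-- The data of a quadratic function on `ℝⁿ` with positive definite matrix `S` (positive
definiteness includes symmetry) and linear part `b`. -/
structure PosDefQuadratic (n : ℕ) where
  S : Matrix (Fin n) (Fin n) ℝ
  b : EuclideanSpace ℝ (Fin n)
  posDef : S.PosDef

namespace PosDefQuadratic

variable {n : ℕ}

/-- The function `f(x) = ½ xᵀ S x + bᵀ x`. -/
def toFun (f : PosDefQuadratic n) (x : EuclideanSpace ℝ (Fin n)) : ℝ :=
  1 / 2 * (x.ofLp ⬝ᵥ (f.S *ᵥ x.ofLp)) + f.b.ofLp ⬝ᵥ x.ofLp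

/-- The minimizer `x* = -S⁻¹ b`. -/
def minimizer (f : PosDefQuadratic n) : EuclideanSpace ℝ (Fin n) :=
  WithLp.toLp 2 (-(f.S⁻¹ *ᵥ f.b.ofLp))

end PosDefQuadratic

/-- The class of functions `f(x) = ½ xᵀ S x + bᵀ x` on `ℝⁿ` with `S` positive definite that are
`ℓ`-smooth (differentiable with `ℓ`-Lipschitz gradient) and whose minimizer `x* = -S⁻¹ b` has norm
at most `D`. -/
def quadClass (n : ℕ) (ℓ D : ℝ) : Set (PosDefQuadratic n) :=
  {f | (Differentiable ℝ f.toFun ∧ LipschitzWith ℓ.toNNReal (gradient f.toFun)) ∧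
    ‖f.minimizer‖ ≤ D}

end

/-! On the line spanned by a vector of norm `D`, with the quadratic `t (x - u)² / 2`, the algorithm
is a scalar linear recursion of order `p` whose coefficients are affine in `t`; at `u = 0`, a root
`z` of its characteristic polynomial gives an error of order `min(1, |z|)^T`. If `t = ℓ` has a root
of modulus at least 1, the error does not decay. Otherwise the coefficients at `t = ℓ` are at most
`2^p`.

If `∑ β ≠ 1`, the recursion cannot rest at a nonzero `u`, so a fixed gap remains
(`exists_gap_of_sum_ne_one`). If `∑ β = 1`, then 1 is a root at `t = 0`, and for small `t` some root
has modulus at least `1 - K t` (`exists_root_norm_ge_one_sub`). Taking `t` of order `ℓ / T` keeps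
`|z|^T` bounded below, and the gap is of order `t`.

The root bound holds even when 1 is a multiple root. Were all roots `z` smaller, the numbers `w =
1/(1 - z)` would satisfy `δ |w|² ≤ Re w` with `δ = K t`. Their elementary symmetric functions are
the Taylor coefficients at 1 divided by the value at 1, which has order `t`: bounded below the
multiplicity `m`, of order `1/t` at `m`. These facts are incompatible. -/

section Roots

/-! ### Roots near 1 of a perturbed polynomial -/

open Polynomial

/-- If every element of `W` has norm at most `B`, the `k`-th coefficient of `∏ (1 + w X)` has norm
at most `2 ^ card W * B ^ k`. -/
theorem norm_coeff_prod_one_add_C_mul_X_le {B : ℝ} (hB : 0 ≤ B) (W : Multiset ℂ)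
    (hW : ∀ w ∈ W, ‖w‖ ≤ B) (k : ℕ) :
    ‖((W.map fun w => 1 + C w * X).prod).coeff k‖ ≤ 2 ^ Multiset.card W * B ^ k := by
  induction W using Multiset.induction_on generalizing k with
  | empty =>
    rcases k with _ | k
    · simp
    · simp [coeff_one]; positivity
  | cons a W ih =>
    have ha := hW a (by simp)
    have ih' := ih fun w hw => hW w (by simp [hw])
    rw [Multiset.map_cons, Multiset.prod_cons, add_mul, one_mul, coeff_add, mul_assoc, coeff_C_mul,
      Multiset.card_cons, pow_succ]
    rcases k with _ | k
    · have := ih' 0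
      simp only [coeff_X_mul_zero, mul_zero, add_zero, pow_zero, mul_one] at this ⊢
      have : (0 : ℝ) < 2 ^ Multiset.card W := by positivity
      linarith
    · rw [coeff_X_mul]
      have h2 : ‖a‖ * ‖((W.map fun w => 1 + C w * X).prod).coeff k‖
          ≤ B * (2 ^ Multiset.card W * B ^ k) := by
        gcongr
        exact ih' k
      calc _ ≤ ‖((W.map fun w => 1 + C w * X).prod).coeff (k + 1)‖
            + ‖a * ((W.map fun w => 1 + C w * X).prod).coeff k‖ := norm_add_le _ _
        _ ≤ 2 ^ Multiset.card W * B ^ (k + 1) + B * (2 ^ Multiset.card W * B ^ k) := by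
            rw [norm_mul]; exact add_le_add (ih' _) h2
        _ = _ := by ring

theorem coeff_zero_prod_one_add_C_mul_X (W : Multiset ℂ) :
    ((W.map fun w => 1 + C w * X).prod).coeff 0 = 1 := by
  induction W using Multiset.induction_on with
  | empty => simp
  | cons a W ih => simp [add_mul, mul_assoc, mul_coeff_zero, ih]

theorem coeff_one_prod_one_add_C_mul_X (W : Multiset ℂ) :
    ((W.map fun w => 1 + C w * X).prod).coeff 1 = W.sum := by
  induction W using Multiset.induction_on with
  | empty => simp [coeff_one]
  | cons a W ih =>
    rw [Multiset.map_cons, Multiset.prod_cons, add_mul, one_mul, coeff_add, mul_assoc, coeff_C_mul,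
      coeff_X_mul, ih, coeff_zero_prod_one_add_C_mul_X, Multiset.sum_cons]
    ring

theorem two_mul_coeff_two_prod_one_add_C_mul_X (W : Multiset ℂ) :
    2 * ((W.map fun w => 1 + C w * X).prod).coeff 2 = W.sum ^ 2 - (W.map (· ^ 2)).sum := by
  induction W using Multiset.induction_on with
  | empty => simp [coeff_one]
  | cons a W ih =>
    rw [Multiset.map_cons, Multiset.prod_cons, add_mul, one_mul, coeff_add, mul_assoc, coeff_C_mul,
      coeff_X_mul, mul_add, ih, coeff_one_prod_one_add_C_mul_X, Multiset.sum_cons,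
      Multiset.map_cons, Multiset.sum_cons]
    ring

theorem Multiset.re_sum (W : Multiset ℂ) : W.sum.re = (W.map Complex.re).sum := by
  induction W using Multiset.induction_on with
  | empty => simp
  | cons a W ih => simp [ih]

/-- If the first two elementary symmetric functions of numbers with nonnegative real part are
bounded by `K`, then so are the numbers themselves. -/
theorem norm_sq_le_of_coeff_le {K : ℝ} (hK : 1 ≤ K) (W : Multiset ℂ) (hre : ∀ w ∈ W, 0 ≤ w.re)
    (h1 : ‖((W.map fun w => 1 + C w * X).prod).coeff 1‖ ≤ K)
    (h2 : ‖((W.map fun w => 1 + C w * X).prod).coeff 2‖ ≤ K) :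
    ∀ w ∈ W, ‖w‖ ^ 2 ≤ (2 * Multiset.card W + 3) * K ^ 2 := by
  rw [coeff_one_prod_one_add_C_mul_X] at h1
  have hreK : ∀ w ∈ W, w.re ≤ K := fun w hw => by
    have := Multiset.single_le_sum (s := W.map Complex.re)
      (by simpa using hre) w.re (Multiset.mem_map_of_mem _ hw)
    rw [← Multiset.re_sum] at this
    exact this.trans ((Complex.re_le_norm _).trans h1)
  have h3 := two_mul_coeff_two_prod_one_add_C_mul_X W
  have h4 : -(W.map (· ^ 2)).sum.re ≤ K ^ 2 + 2 * K := by
    have h5 : -(W.map (· ^ 2)).sum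
        = 2 * ((W.map fun w => 1 + C w * X).prod).coeff 2 - W.sum ^ 2 := by rw [h3]; ring
    rw [← Complex.neg_re, h5]
    refine (Complex.re_le_norm _).trans ((norm_sub_le _ _).trans ?_)
    rw [norm_mul, norm_pow, Complex.norm_ofNat]
    have : ‖W.sum‖ ^ 2 ≤ K ^ 2 := by gcongr
    linarith
  -- Pointwise `|w|² = 2 (Re w)² - Re (w²)`, and Newton's identity has bounded the sum of the last
  -- term.
  have h6 : (W.map fun w => ‖w‖ ^ 2).sum
      = -(W.map (· ^ 2)).sum.re + 2 * (W.map fun w => w.re ^ 2).sum := by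
    clear * -
    induction W using Multiset.induction_on with
    | empty => simp
    | cons a W ih =>
      simp only [Multiset.map_cons, Multiset.sum_cons, ih, Complex.add_re]
      rw [← Complex.normSq_eq_norm_sq, Complex.normSq_apply]
      simp only [pow_two, Complex.mul_re]
      ring
  have h7 : (W.map fun w => w.re ^ 2).sum ≤ Multiset.card W * K ^ 2 := by
    have := Multiset.sum_le_card_nsmul (W.map fun w => w.re ^ 2) (K ^ 2) (by
      intro x hx
      obtain ⟨w, hw, rfl⟩ := Multiset.mem_map.1 hx
      have := hre w hw
      have := hreK w hw
      gcongr)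
    simpa using this
  intro w hw
  have h8 := Multiset.single_le_sum (s := W.map fun w => ‖w‖ ^ 2)
    (by intro x hx; obtain ⟨w, -, rfl⟩ := Multiset.mem_map.1 hx; positivity) _
    (Multiset.mem_map_of_mem _ hw)
  have h9 : (W.map fun w => ‖w‖ ^ 2).sum ≤ (2 * Multiset.card W + 3) * K ^ 2 := by
    rw [h6]; nlinarith
  exact h8.trans h9

/-- `Re (1/(1 - z)) = Re (1 - z) · |1/(1 - z)|²`, and `Re (1 - z) ≥ 1 - |z|`. -/
theorem mul_norm_sq_inv_one_sub_le {z : ℂ} {δ : ℝ} (hz : ‖z‖ < 1 - δ) :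
    δ * ‖(1 - z)⁻¹‖ ^ 2 ≤ ((1 - z)⁻¹).re := by
  have h := Complex.re_le_norm z
  rw [Complex.inv_re, norm_inv, inv_pow, Complex.normSq_eq_norm_sq, ← div_eq_mul_inv]
  gcongr
  simp only [Complex.sub_re, Complex.one_re]
  linarith

/-- A monic polynomial over `ℂ` without the root `1`, expanded at `1`. -/
theorem taylor_one_eq_C_mul_prod (q : ℂ[X]) (hq : q.Monic) (h1 : q.eval 1 ≠ 0) :
    taylor 1 q = C (q.eval 1) *
      ((q.roots.map fun z => (1 - z)⁻¹).map fun w => 1 + C w * X).prod := by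
  have hs : q = (q.roots.map fun z => X - C z).prod := by
    simpa [hq.leadingCoeff] using (IsAlgClosed.splits q).eq_prod_roots
  have hne : ∀ z ∈ q.roots, 1 - z ≠ 0 := fun z hz h => by
    rw [sub_eq_zero] at h
    exact h1 (h ▸ (mem_roots'.1 hz).2)
  generalize q.roots = W at hs hne
  subst hs
  clear * - hne
  induction W using Multiset.induction_on with
  | empty => simp
  | cons a W ih =>
    have ha := hne a (by simp)
    have ih' := ih fun z hz => hne z (by simp [hz])
    simp only [Multiset.map_cons, Multiset.prod_cons, taylor_mul, eval_mul, C_mul]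
    rw [ih']
    have : taylor 1 (X - C a) = C (eval 1 (X - C a)) * (1 + C (1 - a)⁻¹ * X) := by
      rw [map_sub, taylor_X, taylor_C, eval_sub, eval_X, eval_C, mul_add, ← mul_assoc, ← C_mul,
        mul_inv_cancel₀ ha]
      simp
      ring
    rw [this]
    ring

/-- The perturbation `q - t r` of a monic polynomial `q` with `q(1) = 0` has, for small `t > 0`, a
root whose modulus is at least `1 - O(t)`. -/
theorem exists_root_norm_ge_one_sub (q r : ℂ[X]) (hq : q.Monic) (hr : r.degree < q.degree)
    (h1 : q.eval 1 = 0) :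
    ∃ K > (0 : ℝ), ∃ t₀ > (0 : ℝ), ∀ t : ℝ, 0 < t → t ≤ t₀ →
      ∃ z : ℂ, (q - C (t : ℂ) * r).eval z = 0 ∧ 1 - K * t ≤ ‖z‖ := by
  by_cases hr1 : r.eval 1 = 0
  · exact ⟨1, one_pos, 1, one_pos, fun t ht _ => ⟨1, by simp [h1, hr1], by simp [ht.le]⟩⟩
  set ρ := ‖r.eval 1‖ with hρ
  have hρ0 : 0 < ρ := norm_pos_iff.2 hr1
  set Q := taylor 1 q with hQ
  set R := taylor 1 r with hR
  have hQ0 : Q.coeff 0 = 0 := by rw [hQ, taylor_coeff_zero, h1]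
  have hex : ∃ m, Q.coeff m ≠ 0 := by
    by_contra! h
    have : Q = 0 := by ext m; simp [h m]
    exact hq.ne_zero ((taylor_eq_zero (r := (1 : ℂ)) (f := q)).1 this)
  classical
  set m := Nat.find hex with hm
  have hm0 : Q.coeff m ≠ 0 := Nat.find_spec hex
  have hmin : ∀ k < m, Q.coeff k = 0 := fun k hk => not_not.1 (Nat.find_min hex hk)
  have hmpos : 1 ≤ m := Nat.one_le_iff_ne_zero.2 fun h => hm0 (h ▸ hQ0)
  set κ := ‖Q.coeff m‖ with hκ
  have hκ0 : 0 < κ := norm_pos_iff.2 hm0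
  set p := q.natDegree with hp
  set L := (‖R.coeff 1‖ + ‖R.coeff 2‖) / ρ + 1 with hL
  have hL1 : 1 ≤ L := by rw [hL]; have : 0 ≤ (‖R.coeff 1‖ + ‖R.coeff 2‖) / ρ := by positivity
                         linarith
  -- `M` bounds all `w` when `m ≥ 3`, and `t₂` contradicts it; `K` serves `m = 1, 2`; `t₁` keeps the
  -- perturbation of the `m`-th coefficient below `κ / 2`.
  set M := Real.sqrt ((2 * p + 3) * L ^ 2) with hM
  set K := 2 ^ (p + 1) * L * ρ / κ + 1 with hK
  have hK0 : 0 < K := by positivity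
  set t₁ := κ / (2 * (‖R.coeff m‖ + 1)) with ht₁
  set t₂ := κ / (2 ^ (p + 1) * M ^ m * ρ + 1) with ht₂
  have hM0 : 0 ≤ M := Real.sqrt_nonneg _
  refine ⟨K, hK0, min t₁ t₂, lt_min (by positivity) (by positivity), fun t ht htt => ?_⟩
  by_contra! hz
  set δ := K * t with hδ
  have hδ0 : 0 < δ := by positivity
  set g := q - C (t : ℂ) * r with hg
  have hdeg : (C (t : ℂ) * r).degree < q.degree := by
    refine lt_of_le_of_lt ?_ hr
    rw [← smul_eq_C_mul]
    exact degree_smul_le _ _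
  have hgm : g.Monic := hq.sub_of_left hdeg
  have hgn : g.natDegree = p := by
    rw [hp, hg]
    exact natDegree_eq_of_degree_eq (degree_sub_eq_left_of_degree_lt hdeg)
  have hg1 : g.eval 1 = -(t * r.eval 1) := by simp [hg, h1]
  have hg1n : ‖g.eval 1‖ = t * ρ := by simp [hg1, abs_of_pos ht, hρ]
  have hg10 : g.eval 1 ≠ 0 := by rw [← norm_pos_iff, hg1n]; positivity
  have hfac := taylor_one_eq_C_mul_prod g hgm hg10
  set W := g.roots.map fun z => (1 - z)⁻¹ with hW
  have hWc : Multiset.card W = p := by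
    rw [hW, Multiset.card_map, ← hgn]
    exact (splits_iff_card_roots.1 (IsAlgClosed.splits g))
  have hWre : ∀ w ∈ W, δ * ‖w‖ ^ 2 ≤ w.re := by
    intro w hw
    obtain ⟨z, hzr, rfl⟩ := Multiset.mem_map.1 hw
    exact mul_norm_sq_inv_one_sub_le (hz z (mem_roots'.1 hzr).2)
  have hcoeff : ∀ k, Q.coeff k - t * R.coeff k
      = g.eval 1 * ((W.map fun w => 1 + C w * X).prod).coeff k := by
    intro k
    rw [← coeff_C_mul, ← coeff_C_mul, ← hfac, hg, map_sub, taylor_mul, taylor_C, coeff_sub]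
  have hE : ∀ k, ‖((W.map fun w => 1 + C w * X).prod).coeff k‖
      = ‖Q.coeff k - t * R.coeff k‖ / (t * ρ) := by
    intro k
    rw [hcoeff, norm_mul, hg1n, mul_div_cancel_left₀ _ (by positivity)]
  have hsmall : ∀ k < m, ‖((W.map fun w => 1 + C w * X).prod).coeff k‖ = ‖R.coeff k‖ / ρ := by
    intro k hk
    rw [hE, hmin k hk, zero_sub, norm_neg, norm_mul, Complex.norm_real, Real.norm_of_nonneg ht.le,
      mul_div_mul_left _ _ ht.ne']
  have hbig : κ / (2 * (t * ρ)) ≤ ‖((W.map fun w => 1 + C w * X).prod).coeff m‖ := by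
    rw [hE, ← div_div]
    gcongr
    have h2 : ‖(t : ℂ) * R.coeff m‖ ≤ κ / 2 := by
      rw [norm_mul, Complex.norm_real, Real.norm_of_nonneg ht.le]
      have h3 : t ≤ t₁ := htt.trans (min_le_left _ _)
      rw [ht₁, le_div_iff₀ (by positivity)] at h3
      nlinarith
    have := norm_sub_norm_le (Q.coeff m) (t * R.coeff m)
    linarith
  have hcontra : ∀ B : ℝ, 0 ≤ B → (∀ w ∈ W, ‖w‖ ≤ B) →
      κ ≤ 2 ^ (p + 1) * B ^ m * ρ * t := by
    intro B hB hWB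
    have h2 := hbig.trans (norm_coeff_prod_one_add_C_mul_X_le hB W hWB m)
    rw [hWc, div_le_iff₀ (by positivity)] at h2
    calc κ ≤ _ := h2
      _ = _ := by ring
  have hL0 : (0:ℝ) < L := by linarith
  have hKκ : 2 ^ (p + 1) * L * ρ < K * κ := by
    rw [hK, add_mul, div_mul_cancel₀ _ hκ0.ne']
    linarith
  have hle1 : ‖R.coeff 1‖ / ρ ≤ L := by
    rw [hL, add_div]; have : 0 ≤ ‖R.coeff 2‖ / ρ := by positivity
    linarith
  have hle2 : ‖R.coeff 2‖ / ρ ≤ L := by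
    rw [hL, add_div]; have : 0 ≤ ‖R.coeff 1‖ / ρ := by positivity
    linarith
  obtain hm1 | hm2 | hm3 : m = 1 ∨ m = 2 ∨ 3 ≤ m := by omega
  -- For `m = 1` the disc condition alone gives `|w| ≤ 1/δ`.
  · have := hcontra δ⁻¹ (by positivity) fun w hw => by
      have h2 := (hWre w hw).trans (Complex.re_le_norm w)
      rcases (norm_nonneg w).eq_or_lt with h0 | h0
      · rw [← h0]; positivity
      · rw [← one_div, le_div_iff₀ hδ0]
        nlinarith
    rw [hm1, hδ, pow_one] at this
    have h3 : 2 ^ (p + 1) * (K * t)⁻¹ * ρ * t = 2 ^ (p + 1) * ρ / K := by field_simp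
    rw [h3, le_div_iff₀ hK0] at this
    have h4 : 2 ^ (p + 1) * ρ * 1 ≤ 2 ^ (p + 1) * ρ * L := by gcongr
    nlinarith
  -- For `m = 2` the sum of the `w` is bounded too, so `δ |w|² ≤ Re w ≤ L`.
  · have := hcontra (Real.sqrt (L / δ)) (Real.sqrt_nonneg _) fun w hw => by
      apply Real.le_sqrt_of_sq_le
      rw [le_div_iff₀ hδ0, mul_comm]
      refine (hWre w hw).trans ?_
      have h2 := Multiset.single_le_sum (s := W.map Complex.re)
        (by intro x hx; obtain ⟨w, hw, rfl⟩ := Multiset.mem_map.1 hx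
            exact le_trans (by positivity) (hWre w hw)) w.re (Multiset.mem_map_of_mem _ hw)
      rw [← Multiset.re_sum] at h2
      refine h2.trans ((Complex.re_le_norm _).trans ?_)
      rw [← coeff_one_prod_one_add_C_mul_X, hsmall 1 (by omega)]
      exact hle1
    rw [hm2, Real.sq_sqrt (by positivity), hδ] at this
    have h3 : 2 ^ (p + 1) * (L / (K * t)) * ρ * t = 2 ^ (p + 1) * L * ρ / K := by field_simp
    rw [h3, le_div_iff₀ hK0] at this
    linarith
  -- For `m ≥ 3` the first two symmetric functions are bounded, hence so is every `w`, independently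
  -- of `t`.
  · have := hcontra M hM0 fun w hw => by
      apply Real.le_sqrt_of_sq_le
      have := norm_sq_le_of_coeff_le hL1 W
        (fun w hw => le_trans (by positivity) (hWre w hw))
        (by rw [hsmall 1 (by omega)]; exact hle1) (by rw [hsmall 2 (by omega)]; exact hle2) w hw
      rwa [hWc] at this
    have h3 : t ≤ t₂ := htt.trans (min_le_right _ _)
    rw [ht₂, le_div_iff₀ (by positivity)] at h3
    linarith

end Roots

/-! ### Orbits and their characteristic polynomial -/

namespace SCLI

open Polynomial

section Orbit

variable {p : ℕ} {E E' : Type*} [AddCommGroup E] [Module ℝ E] [AddCommGroup E'] [Module ℝ E']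

theorem orbit_of_lt (A : SCLI p) (F : E → E) (init : Fin p → E) {s : ℕ} (h : s < p) :
    A.orbit F init s = init ⟨s, h⟩ := by
  rw [orbit, dif_pos h]

theorem orbit_add (A : SCLI p) (F : E → E) (init : Fin p → E) (s : ℕ) :
    A.orbit F init (s + p) = ∑ j : Fin p,
      (A.α j • F (A.orbit F init (s + j)) + A.β j • A.orbit F init (s + j)) := by
  rw [orbit, dif_neg (by omega), Nat.add_sub_cancel]

theorem orbit_unique (A : SCLI p) (F : E → E) (x : ℕ → E)
    (hx : ∀ s, x (s + p) = ∑ j : Fin p, (A.α j • F (x (s + j)) + A.β j • x (s + j))) (s : ℕ) :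
    A.orbit F (fun j => x j) s = x s := by
  induction s using Nat.strong_induction_on with
  | _ s ih =>
    by_cases h : s < p
    · rw [orbit_of_lt _ _ _ h]
    · obtain ⟨r, rfl⟩ := Nat.exists_eq_add_of_le' (not_lt.1 h)
      rw [orbit_add, hx]
      refine Finset.sum_congr rfl fun j _ => ?_
      rw [ih (r + j) (by omega)]

theorem orbit_shift (A : SCLI p) (F : E → E) (init : Fin p → E) (k s : ℕ) :
    A.orbit F (fun j => A.orbit F init (j + k)) s = A.orbit F init (s + k) :=
  A.orbit_unique F (fun s => A.orbit F init (s + k)) (fun s => by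
    rw [add_right_comm, orbit_add]
    simp only [add_right_comm]) s

theorem orbit_map (A : SCLI p) (F : E → E) (F' : E' → E') (φ : E →ₗ[ℝ] E')
    (h : ∀ x, F' (φ x) = φ (F x)) (init : Fin p → E) (s : ℕ) :
    A.orbit F' (fun j => φ (init j)) s = φ (A.orbit F init s) := by
  rw [← A.orbit_unique F' (fun s => φ (A.orbit F init s))]
  · congr 1
    ext j
    rw [orbit_of_lt _ _ _ j.isLt]
  · intro s
    simp [orbit_add, h]

end Orbit

variable {p : ℕ}

/-- The characteristic polynomial of the linear recursion that the algorithm generates on the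
operator `x ↦ t x`. -/
noncomputable def charPoly (A : SCLI p) (t : ℝ) : ℂ[X] :=
  X ^ p - ∑ j : Fin p, C ((A.α j * t + A.β j : ℝ) : ℂ) * X ^ (j : ℕ)

theorem degree_sum_C_mul_X_pow_lt (a : Fin p → ℂ) :
    (∑ j : Fin p, C (a j) * X ^ (j : ℕ)).degree < (p : WithBot ℕ) := by
  refine (degree_sum_le _ _).trans_lt ((Finset.sup_lt_iff (WithBot.bot_lt_coe p)).2 fun j _ => ?_)
  exact (degree_C_mul_X_pow_le _ _).trans_lt (WithBot.coe_lt_coe.2 (Nat.cast_lt.2 j.isLt))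

theorem degree_sum_C_mul_X_pow_lt' (a : Fin p → ℂ) :
    (∑ j : Fin p, C (a j) * X ^ (j : ℕ)).degree < (X ^ p : ℂ[X]).degree := by
  rw [degree_X_pow]; exact degree_sum_C_mul_X_pow_lt a

theorem charPoly_monic (A : SCLI p) (t : ℝ) : (A.charPoly t).Monic :=
  (monic_X_pow p).sub_of_left (degree_sum_C_mul_X_pow_lt' _)

theorem degree_charPoly (A : SCLI p) (t : ℝ) : (A.charPoly t).degree = p := by
  rw [charPoly, degree_sub_eq_left_of_degree_lt (degree_sum_C_mul_X_pow_lt' _), degree_X_pow]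

theorem natDegree_charPoly (A : SCLI p) (t : ℝ) : (A.charPoly t).natDegree = p :=
  natDegree_eq_of_degree_eq_some (A.degree_charPoly t)

theorem charPoly_eq (A : SCLI p) (t : ℝ) :
    A.charPoly t = A.charPoly 0 - C (t : ℂ) * ∑ j : Fin p, C (A.α j : ℂ) * X ^ (j : ℕ) := by
  simp only [charPoly, Finset.mul_sum, sub_sub, ← Finset.sum_add_distrib]
  congr 1
  refine Finset.sum_congr rfl fun j _ => ?_
  simp only [mul_zero, zero_add, Complex.ofReal_add, Complex.ofReal_mul, C_add, C_mul]
  ring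

theorem coeff_charPoly (A : SCLI p) (t : ℝ) (j : Fin p) :
    (A.charPoly t).coeff j = -((A.α j * t + A.β j : ℝ) : ℂ) := by
  rw [charPoly, coeff_sub, coeff_X_pow, if_neg j.isLt.ne, finsetSum_coeff,
    Finset.sum_eq_single j]
  · rw [coeff_C_mul_X_pow, if_pos rfl, zero_sub]
  · intro i _ hi
    rw [coeff_C_mul_X_pow, if_neg fun h => hi (Fin.ext h.symm)]
  · simp

theorem eval_one_charPoly (A : SCLI p) (t : ℝ) :
    (A.charPoly t).eval 1 = ((1 - (t * ∑ j, A.α j + ∑ j, A.β j) : ℝ) : ℂ) := by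
  simp [charPoly, eval_finsetSum, Finset.mul_sum, Finset.sum_add_distrib, mul_comm]

/-- If all roots of the characteristic polynomial lie in the unit disc, its coefficients are
bounded. -/
theorem abs_coeff_le_of_roots (A : SCLI p) (t : ℝ)
    (h : ∀ z : ℂ, (A.charPoly t).eval z = 0 → ‖z‖ ≤ 1) (j : Fin p) :
    |A.α j * t + A.β j| ≤ 2 ^ p := by
  have := coeff_le_of_roots_le (p := A.charPoly t) (f := RingHom.id ℂ) (B := 1) j
    (A.charPoly_monic t) (IsAlgClosed.splits _) (by
      intro z hz
      rw [Polynomial.map_id] at hz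
      exact h z (mem_roots'.1 hz).2)
  rw [Polynomial.map_id, coeff_charPoly, norm_neg, Complex.norm_real, Real.norm_eq_abs, one_pow,
    one_mul, natDegree_charPoly] at this
  exact this.trans (by exact_mod_cast Nat.choose_le_two_pow _ _)

/-- A root `z` of the characteristic polynomial yields an orbit of size `min(1, |z|) ^ s`. -/
theorem exists_le_orbit_of_root (A : SCLI p) {t : ℝ} {z : ℂ} (hz : (A.charPoly t).eval z = 0)
    {s : ℕ} (hs : p ≤ s) :
    ∃ y : Fin p → ℝ, (∀ j, |y j| ≤ 1) ∧ min 1 ‖z‖ ^ s ≤ A.orbit (fun x => t * x) y s := by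
  have hzp : ∀ s, z ^ (s + p) = ∑ j : Fin p, ((A.α j * t + A.β j : ℝ) : ℂ) * z ^ (s + j) := by
    intro s
    simp only [charPoly, eval_sub, eval_pow, eval_X, eval_finsetSum, eval_mul, eval_C,
      sub_eq_zero] at hz
    rw [pow_add, hz, Finset.mul_sum]
    exact Finset.sum_congr rfl fun j _ => by ring
  -- `N` normalizes the initial values; the phase `c` makes `c z^s` real and nonnegative, so taking
  -- real parts loses nothing at time `s`.
  set N : ℝ := max 1 ‖z‖ ^ p with hN
  have hN1 : 1 ≤ N := one_le_pow₀ (le_max_left _ _)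
  have hN0 : 0 < N := by linarith
  set c : ℂ := (starRingEnd ℂ) (z ^ s) / ‖z ^ s‖ with hc
  have hc1 : ‖c‖ ≤ 1 := by
    rw [hc, norm_div, RCLike.norm_conj, Complex.norm_real, norm_norm]
    exact div_self_le_one _
  have hcz : c * z ^ s = (‖z‖ ^ s : ℝ) := by
    rw [hc, div_mul_eq_mul_div, mul_comm, Complex.mul_conj, Complex.normSq_eq_norm_sq,
      ← Complex.ofReal_div, norm_pow]
    congr 1
    rcases eq_or_ne (‖z‖ ^ s) 0 with h | h
    · simp [h]
    · field_simp
  set x : ℕ → ℝ := fun r => (c * z ^ r).re / N with hx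
  have hxr : ∀ r, x (r + p) = ∑ j : Fin p, (A.α j • (t * x (r + j)) + A.β j • x (r + j)) := by
    intro r
    simp only [hx, hzp, Finset.mul_sum, Complex.re_sum, Finset.sum_div]
    refine Finset.sum_congr rfl fun j _ => ?_
    rw [mul_left_comm, Complex.re_ofReal_mul]
    simp only [smul_eq_mul]
    ring
  refine ⟨fun j => x j, fun j => ?_, ?_⟩
  · rw [hx, abs_div, abs_of_pos hN0, div_le_one hN0]
    refine (Complex.abs_re_le_norm _).trans ?_
    rw [norm_mul, norm_pow]
    calc ‖c‖ * ‖z‖ ^ (j : ℕ) ≤ 1 * max 1 ‖z‖ ^ (j : ℕ) := by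
          gcongr
          exact le_max_right _ _
      _ ≤ N := by
          rw [one_mul]
          exact pow_le_pow_right₀ (le_max_left _ _) j.isLt.le
  · rw [A.orbit_unique (fun x => t * x) x hxr, hx]
    simp only [hcz, Complex.ofReal_re]
    rw [le_div_iff₀ hN0, hN]
    rcases le_total ‖z‖ 1 with h | h
    · simp [min_eq_right h, max_eq_left h]
    · simpa [min_eq_left h, max_eq_right h] using pow_le_pow_right₀ h hs

/-! ### Inconsistent algorithms -/

/-- If the algorithm is inconsistent, i.e. `∑ β ≠ 1`, then it stays away from some fixed point
`u`. -/
theorem exists_gap_of_sum_ne_one (hp : 1 ≤ p) (A : SCLI p) (hβ : ∑ j, A.β j ≠ 1) :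
    ∃ ε > (0 : ℝ), ∀ t : ℝ, (∀ j, |A.α j * t + A.β j| ≤ 2 ^ p) → ∀ s : ℕ,
      ∃ u : ℝ, |u| ≤ 1 ∧ ∃ y : Fin p → ℝ, (∀ j, |y j| ≤ 1) ∧
        ε ≤ |A.orbit (fun x => t * (x - u)) y s - u| := by
  set B : ℝ := p * 2 ^ p with hB
  have hB0 : 0 ≤ B := by positivity
  set G : ℝ := B + |∑ j, A.β j| + 1 with hG
  have hG1 : 1 ≤ G := by rw [hG]; have := abs_nonneg (∑ j, A.β j); linarith
  -- From zero the orbit grows by at most `2 G` per step, so this `u` keeps its first `2 p` terms in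
  -- the unit ball.
  set u : ℝ := ((2 * G) ^ (2 * p))⁻¹ with hu
  have hu0 : 0 < u := by positivity
  have hG2 : 1 ≤ 2 * G := by linarith
  have hu1 : u ≤ 1 := inv_le_one_of_one_le₀ (one_le_pow₀ hG2)
  set σ : ℝ := ∑ j, A.β j - 1 with hσ
  have hσ0 : 0 < |σ| := abs_pos.2 (sub_ne_zero.2 hβ)
  refine ⟨|σ| * u / (1 + B), by positivity, fun t ht s => ⟨u, by rwa [abs_of_pos hu0], ?_⟩⟩
  set F : ℝ → ℝ := fun x => t * (x - u) with hF
  set x : ℕ → ℝ := A.orbit F 0 with hx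
  have hcomb : ∀ (v : Fin p → ℝ) (b : ℝ), 0 ≤ b → (∀ j, |v j| ≤ b) →
      |∑ j, (A.α j * t + A.β j) * v j| ≤ B * b := by
    intro v b hb hv
    calc _ ≤ ∑ j, |(A.α j * t + A.β j) * v j| := Finset.abs_sum_le_sum_abs _ _
      _ ≤ ∑ _j : Fin p, 2 ^ p * b := by
          refine Finset.sum_le_sum fun j _ => ?_
          rw [abs_mul]
          exact mul_le_mul (ht j) (hv j) (abs_nonneg _) (by positivity)
      _ = _ := by simp [hB]; ring
  have hrec : ∀ r, x (r + p) = ∑ j : Fin p, (A.α j * t + A.β j) * x (r + j)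
      - t * (∑ j, A.α j) * u := by
    intro r
    rw [hx, orbit_add, Finset.mul_sum, Finset.sum_mul, ← Finset.sum_sub_distrib]
    refine Finset.sum_congr rfl fun j _ => ?_
    simp only [hF, smul_eq_mul]
    ring
  have hα : |t * ∑ j, A.α j| ≤ G := by
    have h1 := hcomb (fun _ => 1) 1 zero_le_one (by simp)
    have h2 : t * ∑ j, A.α j = ∑ j, (A.α j * t + A.β j) * 1 - ∑ j, A.β j := by
      simp only [mul_one, Finset.sum_add_distrib, ← Finset.sum_mul]
      ring
    rw [h2]
    refine (abs_sub _ _).trans ?_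
    rw [hG]
    linarith
  have hxb : ∀ r, |x r| ≤ (2 * G) ^ r * u := by
    intro r
    induction r using Nat.strong_induction_on with
    | _ r ih =>
      by_cases h : r < p
      · rw [hx, orbit_of_lt _ _ _ h, Pi.zero_apply, abs_zero]
        positivity
      · obtain ⟨i, rfl⟩ := Nat.exists_eq_add_of_le' (not_lt.1 h)
        obtain ⟨k, rfl⟩ : ∃ k, p = k + 1 := ⟨p - 1, by omega⟩
        have h1 := hcomb (fun j => x (i + j)) ((2 * G) ^ (i + k) * u) (by positivity) fun j =>
          (ih (i + j) (by omega)).trans (by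
            gcongr
            exact Nat.lt_succ_iff.1 j.isLt)
        have h2 : |t * (∑ j, A.α j) * u| ≤ G * ((2 * G) ^ (i + k) * u) := by
          rw [abs_mul, abs_of_pos hu0]
          have h3 : 1 ≤ (2 * G) ^ (i + k) := one_le_pow₀ hG2
          gcongr
          nlinarith
        have h4 : B * ((2 * G) ^ (i + k) * u) ≤ G * ((2 * G) ^ (i + k) * u) := by
          gcongr
          rw [hG]; have := abs_nonneg (∑ j, A.β j); linarith
        rw [hrec]
        refine (abs_sub _ _).trans ?_
        rw [← add_assoc i k 1, pow_succ]
        linarith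
  have hx1 : ∀ r ≤ 2 * p, |x r| ≤ 1 := by
    intro r hr
    refine (hxb r).trans ?_
    rw [hu, ← div_eq_mul_inv, div_le_one (by positivity)]
    exact pow_le_pow_right₀ hG2 hr
  by_contra! hcon
  -- Each window of this orbit starting at `k ≤ p` is an admissible initialization, so `p + 1`
  -- consecutive terms lie near `u`; the recursion then makes `σ u` too small.
  have hclose : ∀ k ≤ p, |x (s + k) - u| < |σ| * u / (1 + B) := by
    intro k hk
    have h1 := hcon (fun j => x (j + k)) fun j => hx1 _ (by omega)
    rwa [hx, orbit_shift] at h1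
  have h1 := hcomb (fun j => x (s + j) - u) (|σ| * u / (1 + B)) (by positivity)
    fun j => (hclose j j.isLt.le).le
  have h2 := hclose p le_rfl
  have h3 : σ * u = (x (s + p) - u) - ∑ j : Fin p, (A.α j * t + A.β j) * (x (s + j) - u) := by
    rw [hrec]
    simp only [mul_sub, Finset.sum_sub_distrib, ← Finset.sum_mul, Finset.sum_add_distrib, hσ]
    ring
  have h4 : |σ| * u < |σ| * u / (1 + B) + B * (|σ| * u / (1 + B)) := by
    calc |σ| * u = |σ * u| := by rw [abs_mul, abs_of_pos hu0]
      _ ≤ _ := by rw [h3]; exact abs_sub _ _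
      _ < _ := add_lt_add_of_lt_of_le h2 h1
  have h5 : |σ| * u / (1 + B) + B * (|σ| * u / (1 + B)) = |σ| * u := by field_simp
  linarith

/-! ### Scalar lower bound -/

/-- The one-dimensional lower bound, on the quadratics `t (x - u) ^ 2 / 2`. -/
theorem exists_scalar_lower_bound (hp : 1 ≤ p) (A : SCLI p) :
    ∃ c > (0 : ℝ), ∃ T₀ : ℕ, 0 < T₀ ∧ ∀ ℓ : ℝ, 0 < ℓ → ∀ T : ℕ, T₀ ≤ T →
      ∃ t : ℝ, 0 < t ∧ t ≤ ℓ ∧ ∃ u : ℝ, |u| ≤ 1 ∧ ∃ y : Fin p → ℝ, (∀ j, |y j| ≤ 1) ∧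
        c * ℓ / T ≤ t / 2 * (A.orbit (fun x => t * (x - u)) y (T + p - 1) - u) ^ 2 := by
  have key : ∀ T : ℕ, 0 < T → ∀ t : ℝ, 0 < t →
      ∀ z : ℂ, (A.charPoly t).eval z = 0 → ∀ a : ℝ, 0 ≤ a → a ≤ min 1 ‖z‖ ^ (T + p - 1) →
      ∃ u : ℝ, |u| ≤ 1 ∧ ∃ y : Fin p → ℝ, (∀ j, |y j| ≤ 1) ∧
        t / 2 * a ^ 2 ≤ t / 2 * (A.orbit (fun x => t * (x - u)) y (T + p - 1) - u) ^ 2 := by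
    intro T hT t ht z hz a ha haz
    obtain ⟨y, hy, h⟩ := A.exists_le_orbit_of_root hz (s := T + p - 1) (by omega)
    refine ⟨0, by simp, y, hy, ?_⟩
    simp only [sub_zero]
    gcongr
    exact haz.trans h
  have big : ∀ c ≤ (1 / 2 : ℝ), ∀ ℓ : ℝ, 0 < ℓ → ∀ T : ℕ, 0 < T →
      ∀ z : ℂ, (A.charPoly ℓ).eval z = 0 → 1 ≤ ‖z‖ →
      ∃ t : ℝ, 0 < t ∧ t ≤ ℓ ∧ ∃ u : ℝ, |u| ≤ 1 ∧ ∃ y : Fin p → ℝ, (∀ j, |y j| ≤ 1) ∧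
        c * ℓ / T ≤ t / 2 * (A.orbit (fun x => t * (x - u)) y (T + p - 1) - u) ^ 2 := by
    intro c hc ℓ hℓ T hT z hz hz1
    obtain ⟨u, hu, y, hy, h⟩ := key T hT ℓ hℓ z hz 1 zero_le_one (by simp [hz1])
    refine ⟨ℓ, hℓ, le_rfl, u, hu, y, hy, le_trans ?_ h⟩
    have hT1 : (1 : ℝ) ≤ T := by exact_mod_cast hT
    rw [div_le_iff₀ (by positivity)]
    nlinarith
  by_cases hβ : ∑ j, A.β j = 1
  swap
  · obtain ⟨ε, hε, H⟩ := A.exists_gap_of_sum_ne_one hp hβ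
    refine ⟨min (1 / 2) (ε ^ 2 / 2), by positivity, 1, one_pos, fun ℓ hℓ T hT => ?_⟩
    by_cases hz : ∃ z : ℂ, (A.charPoly ℓ).eval z = 0 ∧ 1 ≤ ‖z‖
    · obtain ⟨z, hz, hz1⟩ := hz
      exact big _ (min_le_left _ _) ℓ hℓ T hT z hz hz1
    push Not at hz
    obtain ⟨u, hu, y, hy, h⟩ := H ℓ (A.abs_coeff_le_of_roots ℓ fun z h => (hz z h).le) (T + p - 1)
    refine ⟨ℓ, hℓ, le_rfl, u, hu, y, hy, ?_⟩
    have hT1 : (1 : ℝ) ≤ T := by exact_mod_cast hT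
    rw [← sq_abs (_ - u)]
    calc min (1 / 2) (ε ^ 2 / 2) * ℓ / T ≤ min (1 / 2) (ε ^ 2 / 2) * ℓ :=
          div_le_self (by positivity) hT1
      _ ≤ ε ^ 2 / 2 * ℓ := by gcongr; exact min_le_right _ _
      _ = ℓ / 2 * ε ^ 2 := by ring
      _ ≤ _ := by gcongr
  by_cases hα : ∑ j, A.α j = 0
  · refine ⟨1 / 2, by norm_num, 1, one_pos, fun ℓ hℓ T hT => ?_⟩
    exact big _ le_rfl ℓ hℓ T hT 1 (by rw [eval_one_charPoly]; simp [hα, hβ]) (by simp)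
  obtain ⟨i, -, hi⟩ := Finset.exists_ne_zero_of_sum_ne_zero hα
  obtain ⟨K, hK, t₀, ht₀, H⟩ := exists_root_norm_ge_one_sub (A.charPoly 0)
    (∑ j : Fin p, C (A.α j : ℂ) * X ^ (j : ℕ)) (A.charPoly_monic 0)
    (by rw [degree_charPoly]; exact degree_sum_C_mul_X_pow_lt _)
    (by rw [eval_one_charPoly]; simp [hβ])
  simp only [← charPoly_eq] at H
  -- When all roots at `ℓ` lie in the disc, the bound on `α_i ℓ + β_i` forces `ℓ ≤ Λ`; this frees
  -- `T₀` and `κ` from `ℓ`.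
  set Λ : ℝ := (2 ^ p + |A.β i|) / |A.α i| with hΛ
  have hi0 : 0 < |A.α i| := abs_pos.2 hi
  have hΛ0 : 0 < Λ := by positivity
  set κ : ℝ := 1 / (2 * p * K * Λ + 1) with hκ
  have hκ0 : 0 < κ := by positivity
  have hκ1 : κ ≤ 1 := by
    rw [hκ, div_le_one (by positivity)]
    have : 0 ≤ 2 * p * K * Λ := by positivity
    linarith
  -- With `t = κ ℓ / T` and an error of at least `1/2`, the gap is `t / 2 · (1/2)² = κ ℓ / (8 T)`;
  -- `T ≥ Λ / t₀` ensures `t ≤ t₀`.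
  refine ⟨κ / 8, by positivity, ⌈Λ / t₀⌉₊ + 1, by omega, fun ℓ hℓ T hT => ?_⟩
  have hT0 : 0 < T := by omega
  by_cases hz : ∃ z : ℂ, (A.charPoly ℓ).eval z = 0 ∧ 1 ≤ ‖z‖
  · obtain ⟨z, hz, hz1⟩ := hz
    exact big _ (by linarith) ℓ hℓ T hT0 z hz hz1
  push Not at hz
  have hℓΛ : ℓ ≤ Λ := by
    rw [hΛ, le_div_iff₀ hi0]
    have h1 := A.abs_coeff_le_of_roots ℓ (fun z h => (hz z h).le) i
    have h2 : ℓ * |A.α i| = |(A.α i * ℓ + A.β i) - A.β i| := by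
      rw [add_sub_cancel_right, abs_mul, abs_of_pos hℓ, mul_comm]
    rw [h2]
    exact (abs_sub _ _).trans (by linarith)
  have hT1 : (1 : ℝ) ≤ T := by exact_mod_cast hT0
  have hp1 : (1 : ℝ) ≤ p := by exact_mod_cast hp
  set t : ℝ := κ * ℓ / T with ht
  have ht0 : 0 < t := by positivity
  have htℓ : t ≤ ℓ := by
    rw [ht, div_le_iff₀ (by positivity)]
    nlinarith
  have htt : t ≤ t₀ := by
    have h1 : Λ / t₀ ≤ T := (Nat.le_ceil _).trans (by exact_mod_cast (by omega))
    rw [div_le_iff₀ ht₀] at h1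
    rw [ht, div_le_iff₀ (by positivity)]
    nlinarith
  obtain ⟨z, hz, hzK⟩ := H t ht0 htt
  have hs : ((T + p - 1 : ℕ) : ℝ) * (K * t) ≤ 1 / 2 := by
    have h1 : ((T + p - 1 : ℕ) : ℝ) ≤ p * T := by
      have : T + p - 1 ≤ p * T := by
        obtain ⟨a, rfl⟩ : ∃ a, T = a + 1 := ⟨T - 1, by omega⟩
        obtain ⟨b, rfl⟩ : ∃ b, p = b + 1 := ⟨p - 1, by omega⟩
        have : a + 1 + (b + 1) - 1 = a + b + 1 := by omega
        rw [this]
        nlinarith [Nat.zero_le (a * b)]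
      exact_mod_cast this
    calc ((T + p - 1 : ℕ) : ℝ) * (K * t) ≤ (p * T) * (K * t) := by gcongr
      _ = p * K * κ * ℓ := by rw [ht]; field_simp
      _ ≤ p * K * κ * Λ := by gcongr
      _ ≤ 1 / 2 := by
          rw [hκ, mul_one_div, div_mul_eq_mul_div, div_le_iff₀ (by positivity)]
          linarith
  have hKt1 : K * t ≤ 1 / 2 := by
    have h1 : (1 : ℝ) ≤ ((T + p - 1 : ℕ) : ℝ) := by exact_mod_cast (by omega : 1 ≤ T + p - 1)
    have : 0 < K * t := by positivity
    nlinarith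
  have hpow : 1 / 2 ≤ min 1 ‖z‖ ^ (T + p - 1) := by
    calc (1 / 2 : ℝ) ≤ 1 + ((T + p - 1 : ℕ) : ℝ) * (-(K * t)) := by linarith
      _ ≤ (1 + -(K * t)) ^ (T + p - 1) := one_add_mul_le_pow (by linarith) _
      _ ≤ _ := by
          refine pow_le_pow_left₀ (by linarith) (le_min ?_ (by linarith)) _
          have : 0 < K * t := by positivity
          linarith
  obtain ⟨u, hu, y, hy, h⟩ := key T hT0 t ht0 z hz (1 / 2) (by norm_num) hpow
  refine ⟨t, ht0, htℓ, u, hu, y, hy, le_trans (le_of_eq ?_) h⟩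
  rw [ht]
  ring

end SCLI

/-! ### Isotropic quadratics and reduction to one dimension -/

namespace PosDefQuadratic

variable {n : ℕ}

/-- The quadratic `t ‖x - x₀‖ ^ 2 / 2`, up to an additive constant. -/
noncomputable def isotropic (t : ℝ) (ht : 0 < t) (x₀ : EuclideanSpace ℝ (Fin n)) :
    PosDefQuadratic n where
  S := t • 1
  b := -(t • x₀)
  posDef := Matrix.PosDef.one.smul ht

theorem isotropic_toFun (t : ℝ) (ht : 0 < t) (x₀ x : EuclideanSpace ℝ (Fin n)) :
    (isotropic t ht x₀).toFun x = t / 2 * ‖x - x₀‖ ^ 2 - t / 2 * ‖x₀‖ ^ 2 := by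
  rw [norm_sub_sq_real, ← real_inner_self_eq_norm_sq x]
  simp only [toFun, isotropic, EuclideanSpace.inner_eq_star_dotProduct, smul_mulVec, one_mulVec,
    dotProduct_smul, WithLp.ofLp_neg, WithLp.ofLp_smul, neg_dotProduct, smul_dotProduct,
    smul_eq_mul, star_trivial]
  ring

theorem isotropic_minimizer (t : ℝ) (ht : 0 < t) (x₀ : EuclideanSpace ℝ (Fin n)) :
    (isotropic t ht x₀).minimizer = x₀ := by
  have h : (t • (1 : Matrix (Fin n) (Fin n) ℝ))⁻¹ = t⁻¹ • 1 := by
    apply Matrix.inv_eq_right_inv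
    simp [smul_smul, ht.ne']
  simp [minimizer, isotropic, h, smul_mulVec, mulVec_neg, smul_smul, ht.ne']

theorem isotropic_hasGradientAt (t : ℝ) (ht : 0 < t) (x₀ x : EuclideanSpace ℝ (Fin n)) :
    HasGradientAt (isotropic t ht x₀).toFun (t • (x - x₀)) x := by
  have h1 : (isotropic t ht x₀).toFun = fun x => t / 2 * ‖x - x₀‖ ^ 2 - t / 2 * ‖x₀‖ ^ 2 :=
    funext fun x => isotropic_toFun t ht x₀ x
  rw [h1, hasGradientAt_iff_hasFDerivAt]
  have h2 := ((((hasFDerivAt_id x).sub_const x₀).norm_sq).const_mul (t / 2)).sub_const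
    (t / 2 * ‖x₀‖ ^ 2)
  refine h2.congr_fderiv ?_
  ext v
  simp
  ring

theorem isotropic_gradient (t : ℝ) (ht : 0 < t) (x₀ : EuclideanSpace ℝ (Fin n)) :
    gradient (isotropic t ht x₀).toFun = fun x => t • (x - x₀) :=
  funext fun x => (isotropic_hasGradientAt t ht x₀ x).gradient

theorem isotropic_mem_quadClass {t ℓ D : ℝ} (ht : 0 < t) (htℓ : t ≤ ℓ)
    {x₀ : EuclideanSpace ℝ (Fin n)} (hx₀ : ‖x₀‖ ≤ D) : isotropic t ht x₀ ∈ quadClass n ℓ D := by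
  refine ⟨⟨fun x => (isotropic_hasGradientAt t ht x₀ x).differentiableAt, ?_⟩, ?_⟩
  · rw [isotropic_gradient]
    refine LipschitzWith.of_dist_le_mul fun x y => ?_
    rw [dist_eq_norm, dist_eq_norm, ← smul_sub, sub_sub_sub_cancel_right, norm_smul,
      Real.norm_of_nonneg ht.le, Real.coe_toNNReal _ (ht.le.trans htℓ)]
    gcongr
  · rwa [isotropic_minimizer]

end PosDefQuadratic

theorem mainTheorem8 (p : ℕ) (hp : 1 ≤ p) (A : SCLI p) :
    ∃ c : ℝ, 0 < c ∧ ∃ T₀ : ℕ, 0 < T₀ ∧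
      ∀ (n : ℕ) (_ : 1 ≤ n) (ℓ D : ℝ) (_ : 0 < ℓ) (_ : 0 < D) (T : ℕ) (_ : T₀ ≤ T),
        ∃ f ∈ quadClass n ℓ D, ∃ init : Fin p → EuclideanSpace ℝ (Fin n),
          (∀ j, init j ∈ Metric.closedBall (0 : EuclideanSpace ℝ (Fin n)) D) ∧
            f.toFun (A.iterate (gradient f.toFun) init (T : ℤ)) - f.toFun f.minimizer
              ≥ c * ℓ * D ^ 2 / (T : ℝ) := by
  obtain ⟨c, hc, T₀, hT₀, H⟩ := A.exists_scalar_lower_bound hp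
  refine ⟨c, hc, T₀, hT₀, fun n hn ℓ D hℓ hD T hT => ?_⟩
  obtain ⟨t, ht, htℓ, u, hu, y, hy, h⟩ := H ℓ hℓ T hT
  obtain ⟨e, he⟩ : ∃ e : EuclideanSpace ℝ (Fin n), ‖e‖ = D :=
    ⟨EuclideanSpace.single ⟨0, hn⟩ D, by simp [hD.le]⟩
  have hnorm : ∀ a : ℝ, |a| ≤ 1 → ‖a • e‖ ≤ D := fun a ha => by
    rw [norm_smul, he, Real.norm_eq_abs]
    exact mul_le_of_le_one_left hD.le ha
  refine ⟨PosDefQuadratic.isotropic t ht (u • e),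
    PosDefQuadratic.isotropic_mem_quadClass ht htℓ (hnorm u hu), fun j => y j • e,
    fun j => by simpa using hnorm _ (hy j), ?_⟩
  -- The map `a ↦ a • e` intertwines the scalar and vector gradients.
  have horb := A.orbit_map (fun x => t * (x - u)) (fun x => t • (x - u • e))
    (LinearMap.toSpanSingleton ℝ _ e)
    (fun x => by simp [LinearMap.toSpanSingleton_apply, mul_smul, sub_smul]) y (T + p - 1)
  simp only [LinearMap.toSpanSingleton_apply] at horb
  have hidx : ((T : ℤ) + p - 1).toNat = T + p - 1 := by omega
  rw [PosDefQuadratic.isotropic_minimizer, PosDefQuadratic.isotropic_gradient, SCLI.iterate, hidx,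
    horb, PosDefQuadratic.isotropic_toFun, PosDefQuadratic.isotropic_toFun, ← sub_smul, norm_smul,
    he, mul_pow, Real.norm_eq_abs, sq_abs, sub_self, norm_zero]
  have h2 := mul_le_mul_of_nonneg_right h (sq_nonneg D)
  have h3 : c * ℓ / T * D ^ 2 = c * ℓ * D ^ 2 / T := by ring
  linarith
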